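/- Let $\mathcal D$ be a compact metric space and let $\mu$ be a Borel probability measure on $\mathcal D^2$ which is symmetric, i.e. invariant under the swap $(x,x')\mapsto(x',x)$. Let $K$ be a continuous real-valued kernel on $\mathcal D^2$, that is, a continuous function of the form $K(x,x',y,y')=\langle\Phi(x,x'),\Phi(y,y')\rangle$ for a map $\Phi$ from $\mathcal D^2$ to a real Hilbert space, and assume $\max_{(x,x')\in\mathcal D^2}K(x,x',x,x')=1$. Define the permutation invariant, symmetric and anti-symmetric forms of $K$ by \begin{align*} K^{PI}(x,x',y,y')&=\tfrac12\big(K(x,x',y,y')+K(x',x,y',y)\big),\\ K^{S}(x,x',y,y')&=\tfrac14\big(K(x,x',y,y')+K(x',x,y,y')+K(x,x',y',y)+K(x',x,y',y)\big),\\ K^{A}(x,x',y,y')&=\tfrac14\big(K(x,x',y,y')-K(x',x,y,y')-K(x,x',y',y)+K(x',x,y',y)\big). \end{align*} For a continuous kernel $k$ on $\mathcal D^2$ with reproducing kernel Hilbert space $\mathcal H(k)$, a function $f\in L^2(\mathcal D^2,\mu)$ (the regression function) and $\lambda>0$, let $h_k^\lambda$ be the unique minimizer over $h\in\mathcal H(k)$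 of $\int_{\mathcal D^2}(f-h)^2\,d\mu+\lambda\|h\|_{\mathcal H(k)}^2$, and let the bias caused by regularization be $\epsilon_{rg}(f,k,\lambda)=\int_{\mathcal D^2}(f-h_k^\lambda)^2\,d\mu$. Let $f\in L^2(\mathcal D^2,\mu)$. Then: 1. If $f$ is symmetric, i.e. $f(x',x)=f(x,x')$ for $\mu$-almost every $(x,x')$, then $\epsilon_{rg}(f,K^{PI},\lambda)=\epsilon_{rg}(f,K^{S},\lambda)$ for every $\lambda>0$. 2. If $f$ is anti-symmetric, i.e. $f(x',x)=-f(x,x')$ for $\mu$-almost every $(x,x')$, then $\epsilon_{rg}(f,K^{PI},\lambda)=\epsilon_{rg}(f,K^{A},\lambda)$ for every $\lambda>0$. 3. If $f$ is symmetric or anti-symmetric, then for every $\lambda>0$ $$\left(1-\frac{(\lambda^2-(\lambda+1)^2)^2}{(\lambda^2+(\lambda+1)^2)^2}\right)\epsilon_{rg}(f,K,\lambda)\le\epsilon_{rg}(f,K^{PI},\lambda)\le\left(1+\frac1{4\lambda^2+4\lambda}\right)\epsilon_{rg}(f,K,\lambda).$$ -/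

import Mathlib

open MeasureTheory

universe u

/-- A continuous real-valued kernel on a topological space `X`: a jointly continuous function of the
form `K(x, y) = ⟨Φ(x), Φ(y)⟩` for some map `Φ` from `X` to a real Hilbert space. -/
structure ContKernel (X : Type u) [TopologicalSpace X] where
  toFun : X → X → ℝ
  continuous_toFun : Continuous fun p : X × X => toFun p.1 p.2
  exists_featureMap : ∃ (F : Type u) (_ : NormedAddCommGroup F) (_ : InnerProductSpace ℝ F)
    (_ : CompleteSpace F) (Φ : X → F), ∀ x y, toFun x y = inner ℝ (Φ x) (Φ y)

namespace ContKernel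

section General

variable {X : Type u} [TopologicalSpace X]

instance : CoeFun (ContKernel X) (fun _ => X → X → ℝ) := ⟨ContKernel.toFun⟩

lemma symm_apply (K : ContKernel X) (x y : X) : K x y = K y x := by
  obtain ⟨F, _, _, _, Φ, hΦ⟩ := K.exists_featureMap
  rw [hΦ, hΦ, real_inner_comm]

/-- The kernel as a matrix of operators `ℝ →L[ℝ] ℝ`, the form used for reproducing kernels in
Mathlib. The entry `(x, y)` is multiplication by `K(x, y)`. -/
noncomputable def toMatrix (K : ContKernel X) : Matrix X X (ℝ →L[ℝ] ℝ) :=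
  Matrix.of fun x y => K x y • ContinuousLinearMap.id ℝ ℝ

lemma toMatrix_apply (K : ContKernel X) (x y : X) (r : ℝ) : K.toMatrix x y r = K x y * r := by
  simp [toMatrix]

lemma posSemidef_toMatrix (K : ContKernel X) : K.toMatrix.PosSemidef := by
  have iff := (RKHS.posSemidef_tfae (K := K.toMatrix)).out 0 2
  refine iff.mpr ⟨?_, ?_⟩
  · ext x y
    have hid : star (ContinuousLinearMap.id ℝ ℝ) = ContinuousLinearMap.id ℝ ℝ :=
      ContinuousLinearMap.adjoint_id
    simp [toMatrix, Matrix.conjTranspose_apply, K.symm_apply x y, hid]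
  · intro v
    obtain ⟨F, _, _, _, Φ, hΦ⟩ := K.exists_featureMap
    have key : (v.sum fun x w => v.sum fun x' w' => inner ℝ (K.toMatrix x' x w) w')
        = inner ℝ (v.sum fun x w => w • Φ x) (v.sum fun x w => w • Φ x) := by
      simp only [Finsupp.sum, sum_inner, inner_sum, toMatrix_apply, hΦ, real_inner_smul_left,
        real_inner_smul_right]
      refine Finset.sum_congr rfl fun x _ => ?_
      refine Finset.sum_congr rfl fun y _ => ?_
      rw [real_inner_comm (Φ x) (Φ y), RCLike.inner_apply, conj_trivial]
      ring
    rw [key]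
    exact real_inner_self_nonneg

instance (K : ContKernel X) : Fact K.toMatrix.PosSemidef := ⟨K.posSemidef_toMatrix⟩

/-- The reproducing kernel Hilbert space of the kernel `K`. Its elements coerce to functions
`X → ℝ`. -/
abbrev Rkhs (K : ContKernel X) : Type u := RKHS.OfKernel K.toMatrix

lemma continuous_coe (K : ContKernel X) (h : K.Rkhs) : Continuous (h : X → ℝ) := by
  have hk : Continuous fun x => RKHS.kerFun K.Rkhs x (1 : ℝ) := by
    have hin : ∀ x y, inner ℝ (RKHS.kerFun K.Rkhs x (1 : ℝ)) (RKHS.kerFun K.Rkhs y (1 : ℝ))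
        = K y x := by
      intro x y
      rw [← RKHS.kernel_inner, RKHS.OfKernel.kernel_ofKernel, toMatrix_apply]
      simp
    rw [continuous_iff_continuousAt]
    intro x
    rw [ContinuousAt, tendsto_iff_norm_sub_tendsto_zero]
    have h1 : ∀ y, ‖RKHS.kerFun K.Rkhs y (1 : ℝ) - RKHS.kerFun K.Rkhs x (1 : ℝ)‖
        = √(K y y - 2 * K x y + K x x) := by
      intro y
      rw [← Real.sqrt_sq (norm_nonneg _), norm_sub_sq_real, ← real_inner_self_eq_norm_sq,
        ← real_inner_self_eq_norm_sq, hin, hin, hin]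
    simp_rw [h1]
    have hc : Continuous fun y => √(K y y - 2 * K x y + K x x) := by
      have a1 : Continuous fun y => K y y :=
        K.continuous_toFun.comp (continuous_id.prodMk continuous_id)
      have a2 : Continuous fun y => K x y :=
        K.continuous_toFun.comp (continuous_const.prodMk continuous_id)
      fun_prop
    have := hc.tendsto x
    convert this using 2
    rw [eq_comm, Real.sqrt_eq_zero']
    linarith
  have : (h : X → ℝ) = fun x => inner ℝ h (RKHS.kerFun K.Rkhs x (1 : ℝ)) := by
    ext x
    rw [RKHS.inner_kerFun]
    simp
  rw [this]
  fun_prop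

variable [MeasurableSpace X]

/-- The regularized mean squared error `∫ (f - h)² dμ + lam ‖h‖²` of an element `h` of the
reproducing kernel Hilbert space of `K`, the target function being `f`. -/
noncomputable def regularizedRisk (K : ContKernel X) (μ : Measure X) (f : X → ℝ) (lam : ℝ)
    (h : K.Rkhs) : ℝ :=
  ∫ x, (f x - h x) ^ 2 ∂μ + lam * ‖h‖ ^ 2

/-- The minimizer of the regularized mean squared error over the reproducing kernel Hilbert space of
`K`. It exists and is unique for square integrable `f` and `lam > 0`, see
`existsUnique_minimizer`. -/
noncomputable def regularizedMinimizer (K : ContKernel X) (μ : Measure X) (f : X → ℝ) (lam : ℝ) :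
    K.Rkhs :=
  Classical.epsilon fun h => ∀ g, K.regularizedRisk μ f lam h ≤ K.regularizedRisk μ f lam g

/-- The bias caused by regularization: the mean squared distance between `f` and the minimizer of
the regularized mean squared error. -/
noncomputable def regularizationBias (K : ContKernel X) (μ : Measure X) (f : X → ℝ) (lam : ℝ) :
    ℝ :=
  ∫ x, (f x - K.regularizedMinimizer μ f lam x) ^ 2 ∂μ

/-- Existence and uniqueness of the minimizer in Tikhonov regularization. -/
lemma existsUnique_tikhonov {E F : Type*} [NormedAddCommGroup E] [InnerProductSpace ℝ E]
    [CompleteSpace E] [NormedAddCommGroup F] [InnerProductSpace ℝ F] [CompleteSpace F]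
    (J : E →L[ℝ] F) (f : F) {lam : ℝ} (hlam : 0 < lam) :
    ∃! h : E, ∀ g : E, ‖f - J h‖ ^ 2 + lam * ‖h‖ ^ 2 ≤ ‖f - J g‖ ^ 2 + lam * ‖g‖ ^ 2 := by
  let A : E →L[ℝ] E := J.adjoint ∘L J + lam • ContinuousLinearMap.id ℝ E
  let B : E →L[ℝ] E →L[ℝ] ℝ := (innerSL ℝ) ∘L A
  have hB : ∀ u v, B u v = inner ℝ (J u) (J v) + lam * inner ℝ u v := by
    intro u v
    change inner ℝ (J.adjoint (J u) + lam • u) v = _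
    rw [inner_add_left, ContinuousLinearMap.adjoint_inner_left, real_inner_smul_left]
  have hco : IsCoercive B := by
    refine ⟨lam, hlam, fun u => ?_⟩
    rw [hB, real_inner_self_eq_norm_sq, real_inner_self_eq_norm_sq]
    nlinarith [sq_nonneg ‖J u‖]
  obtain ⟨u, hu⟩ := hco.continuousLinearEquivOfBilin.surjective (J.adjoint f)
  have hu' : ∀ w, inner ℝ f (J w) = inner ℝ (J u) (J w) + lam * inner ℝ u w := by
    intro w
    rw [← hB, ← hco.continuousLinearEquivOfBilin_apply, hu, ContinuousLinearMap.adjoint_inner_left]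
  have key : ∀ g, ‖f - J g‖ ^ 2 + lam * ‖g‖ ^ 2
      = ‖f - J u‖ ^ 2 + lam * ‖u‖ ^ 2 + ‖J (g - u)‖ ^ 2 + lam * ‖g - u‖ ^ 2 := by
    intro g
    have h1 := hu' (g - u)
    have e1 : f - J g = (f - J u) - J (g - u) := by simp
    have e2 : ‖g‖ ^ 2 = ‖u + (g - u)‖ ^ 2 := by simp
    rw [e1, e2, norm_sub_sq_real, norm_add_sq_real, inner_sub_left]
    linarith
  refine ⟨u, fun g => ?_, fun v hv => ?_⟩
  · rw [key g]
    have := mul_nonneg hlam.le (sq_nonneg ‖g - u‖)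
    nlinarith [sq_nonneg ‖J (g - u)‖]
  · have h1 := hv u
    rw [key v] at h1
    have h2 : lam * ‖v - u‖ ^ 2 ≤ 0 := by nlinarith [sq_nonneg ‖J (v - u)‖]
    have h3 : ‖v - u‖ ^ 2 ≤ 0 := by
      by_contra hc
      push Not at hc
      nlinarith [mul_pos hlam hc]
    have h4 : ‖v - u‖ = 0 := by
      have := sq_nonneg ‖v - u‖
      exact pow_eq_zero_iff (two_ne_zero) |>.mp (le_antisymm h3 this)
    exact sub_eq_zero.mp (norm_eq_zero.mp h4)

variable [CompactSpace X] [OpensMeasurableSpace X]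

lemma memLp_coe (K : ContKernel X) (μ : Measure X) [IsFiniteMeasure μ] (h : K.Rkhs) :
    MemLp (h : X → ℝ) 2 μ := by
  obtain ⟨C, hC⟩ := (isCompact_range (K.continuous_coe h)).isBounded.exists_norm_le
  exact MemLp.of_bound (K.continuous_coe h).aestronglyMeasurable C
    (Filter.Eventually.of_forall fun x => hC _ (Set.mem_range_self x))

lemma existsUnique_minimizer (K : ContKernel X) (μ : Measure X) [IsFiniteMeasure μ] {f : X → ℝ}
    (hf : MemLp f 2 μ) {lam : ℝ} (hlam : 0 < lam) :
    ∃! h : K.Rkhs, ∀ g, K.regularizedRisk μ f lam h ≤ K.regularizedRisk μ f lam g := by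
  have hdiag : Continuous fun x => √(K x x) :=
    (K.continuous_toFun.comp (continuous_id.prodMk continuous_id)).sqrt
  obtain ⟨C, hC⟩ := (isCompact_range hdiag).isBounded.exists_norm_le
  have hbd : ∀ (h : K.Rkhs) (x : X), ‖h x‖ ≤ ‖h‖ * |C| := by
    intro h x
    refine (RKHS.norm_apply_le h x).trans (mul_le_mul_of_nonneg_left ?_ (norm_nonneg _))
    have h1 : ‖RKHS.kernel K.Rkhs x x‖ ≤ |K x x| := by
      rw [RKHS.OfKernel.kernel_ofKernel]
      simp [toMatrix, norm_smul]
    have h0 : 0 ≤ K x x := by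
      obtain ⟨F, _, _, _, Φ, hΦ⟩ := K.exists_featureMap
      rw [hΦ]
      exact real_inner_self_nonneg
    rw [abs_of_nonneg h0] at h1
    exact ((Real.sqrt_le_sqrt h1).trans (le_abs_self _)).trans
      ((hC _ (Set.mem_range_self x)).trans (le_abs_self C))
  let J₀ : K.Rkhs →ₗ[ℝ] Lp ℝ 2 μ :=
    { toFun := fun h => (K.memLp_coe μ h).toLp (h : X → ℝ)
      map_add' := fun g h => by
        rw [← MemLp.toLp_add]
        exact MemLp.toLp_congr _ _ (by rw [RKHS.coe_add])
      map_smul' := fun c h => by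
        rw [RingHom.id_apply, ← MemLp.toLp_const_smul]
        exact MemLp.toLp_congr _ _ (by rw [RKHS.coe_smul]) }
  let J : K.Rkhs →L[ℝ] Lp ℝ 2 μ := J₀.mkContinuous
    ((measureUnivNNReal μ : ℝ) ^ (ENNReal.toReal 2)⁻¹ * |C|) fun h => by
      have := Lp.norm_le_of_ae_bound (f := J₀ h) (C := ‖h‖ * |C|) (by positivity) (by
        filter_upwards [(K.memLp_coe μ h).coeFn_toLp] with x hx
        change ‖((K.memLp_coe μ h).toLp (h : X → ℝ) : X → ℝ) x‖ ≤ _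
        rw [hx]
        exact hbd h x)
      linarith
  have hJ : ∀ h, K.regularizedRisk μ f lam h = ‖hf.toLp f - J h‖ ^ 2 + lam * ‖h‖ ^ 2 := by
    intro h
    have e : hf.toLp f - J h = (hf.sub (K.memLp_coe μ h)).toLp (f - (h : X → ℝ)) :=
      (MemLp.toLp_sub hf (K.memLp_coe μ h)).symm
    rw [regularizedRisk, e,
      ← real_inner_self_eq_norm_sq ((hf.sub (K.memLp_coe μ h)).toLp (f - (h : X → ℝ))),
      L2.inner_def]
    congr 1
    refine integral_congr_ae ?_
    filter_upwards [(hf.sub (K.memLp_coe μ h)).coeFn_toLp] with x hx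
    rw [hx]
    simp [sq]
  simp_rw [hJ]
  exact existsUnique_tikhonov J _ hlam

end General

section Pairwise

variable {D : Type u} [TopologicalSpace D]

lemma continuous_swap_aux (K : ContKernel (D × D)) {a b : D × D → D × D}
    (ha : Continuous a) (hb : Continuous b) :
    Continuous fun p : (D × D) × (D × D) => K (a p.1) (b p.2) :=
  K.continuous_toFun.comp ((ha.comp continuous_fst).prodMk (hb.comp continuous_snd))

/-- The permutation invariant form `K^{PI}` of a pairwise kernel. -/
noncomputable def permInv (K : ContKernel (D × D)) : ContKernel (D × D) where
  toFun x y := 1 / 2 * (K x y + K x.swap y.swap)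
  continuous_toFun := by
    have h1 := continuous_swap_aux K continuous_id continuous_id
    have h2 := continuous_swap_aux K continuous_swap continuous_swap
    exact (h1.add h2).const_mul _
  exists_featureMap := by
    obtain ⟨F, _, _, _, Φ, hΦ⟩ := K.exists_featureMap
    refine ⟨WithLp 2 (F × F), inferInstance, inferInstance, inferInstance,
      fun x => WithLp.toLp 2 ((√(1 / 2) : ℝ) • Φ x, (√(1 / 2) : ℝ) • Φ x.swap), fun x y => ?_⟩
    have h : (√(1 / 2) : ℝ) * √(1 / 2) = 1 / 2 := Real.mul_self_sqrt (by norm_num)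
    simp only [WithLp.prod_inner_apply, inner_smul_left, inner_smul_right, hΦ, conj_trivial]
    linear_combination (-(inner ℝ (Φ x) (Φ y) : ℝ) - inner ℝ (Φ x.swap) (Φ y.swap)) * h

/-- The symmetric form `K^S` of a pairwise kernel. -/
noncomputable def symmForm (K : ContKernel (D × D)) : ContKernel (D × D) where
  toFun x y := 1 / 4 * (K x y + K x.swap y + K x y.swap + K x.swap y.swap)
  continuous_toFun := by
    have h1 := continuous_swap_aux K continuous_id continuous_id
    have h2 := continuous_swap_aux K continuous_swap continuous_id
    have h3 := continuous_swap_aux K continuous_id continuous_swap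
    have h4 := continuous_swap_aux K continuous_swap continuous_swap
    exact (((h1.add h2).add h3).add h4).const_mul _
  exists_featureMap := by
    obtain ⟨F, _, _, _, Φ, hΦ⟩ := K.exists_featureMap
    refine ⟨F, inferInstance, inferInstance, inferInstance,
      fun x => (1 / 2 : ℝ) • (Φ x + Φ x.swap), fun x y => ?_⟩
    simp only [inner_smul_left, inner_smul_right, inner_add_left, inner_add_right, hΦ,
      conj_trivial]
    ring

/-- The anti-symmetric form `K^A` of a pairwise kernel. -/
noncomputable def antisymmForm (K : ContKernel (D × D)) : ContKernel (D × D) where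
  toFun x y := 1 / 4 * (K x y - K x.swap y - K x y.swap + K x.swap y.swap)
  continuous_toFun := by
    have h1 := continuous_swap_aux K continuous_id continuous_id
    have h2 := continuous_swap_aux K continuous_swap continuous_id
    have h3 := continuous_swap_aux K continuous_id continuous_swap
    have h4 := continuous_swap_aux K continuous_swap continuous_swap
    exact (((h1.sub h2).sub h3).add h4).const_mul _
  exists_featureMap := by
    obtain ⟨F, _, _, _, Φ, hΦ⟩ := K.exists_featureMap
    refine ⟨F, inferInstance, inferInstance, inferInstance,
      fun x => (1 / 2 : ℝ) • (Φ x - Φ x.swap), fun x y => ?_⟩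
    simp only [inner_smul_left, inner_smul_right, inner_sub_left, inner_sub_right, hΦ,
      conj_trivial]
    ring

end Pairwise

end ContKernel

/-!
Let `L` be the integral operator of `K` on `L²(μ)`; it is `J J†` for the inclusion `J` of the
reproducing kernel Hilbert space into `L²(μ)`. The normal equation of Tikhonov regularization says
that the residual `r = f - h` of the minimizer solves `(L + lam) r = lam f`, so that the bias is
`‖lam (L + lam)⁻¹ f‖²` (`ContKernel.exists_residual`).

Let `U` be the composition with the swap, a self-adjoint involution since `μ` is symmetric, and let
`P = (1 + σ U) / 2` be the projection onto the symmetric (`σ = 1`) or anti-symmetric (`σ = -1`)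
functions. The integral operator of `K^{PI}` is `(L + U L U) / 2`. It commutes with `U` and agrees
with `P L P` on the range of `P`; the operator `P L P` belongs to `K^S` or `K^A`. For `f` in the
range of `P` the residuals for these kernels therefore coincide.

For the two-sided bound put `A = L + lam`. As `K ≤ 1` on the diagonal, `0 ≤ L ≤ 1`, so the spectrum
of `A` lies in `[lam, lam + 1]`. The residual `u` for `K` and the residual `s = P s` for `K^{PI}`
satisfy `A u = P A s`. The upper bound on `‖s‖` is dual to `‖A w‖² ≤ C ‖P A w‖²` for `w` in the range
of `P`, which is the Kantorovich inequality for `A`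
(`FirmlyNonexpansive.compressed_norm_sq_le`). For the lower bound, `A u` and `A (s - u)` are
orthogonal, so that by the Wielandt inequality for `A²` the angle between `u` and `s - u` is bounded
away from `π`, and `s` cannot be much shorter than `u`
(`FirmlyNonexpansive.le_compressed_norm_sq`).
-/

/-! ### Firmly nonexpansive operators on a Hilbert space -/

section Hilbert

variable {E : Type*} [NormedAddCommGroup E] [InnerProductSpace ℝ E] {L P : E →L[ℝ] E} {lam : ℝ}

/-- A symmetric operator with `‖L x‖² ≤ ⟨L x, x⟩`, equivalently `0 ≤ L ≤ 1`. -/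
structure FirmlyNonexpansive (L : E →L[ℝ] E) : Prop where
  inner_symm : ∀ x y, inner ℝ (L x) y = inner ℝ x (L y)
  norm_sq_le : ∀ x, ‖L x‖ ^ 2 ≤ inner ℝ (L x) x

namespace FirmlyNonexpansive

lemma inner_nonneg (hL : FirmlyNonexpansive L) (x : E) : 0 ≤ inner ℝ (L x) x :=
  (sq_nonneg _).trans (hL.norm_sq_le x)

lemma norm_le (hL : FirmlyNonexpansive L) (x : E) : ‖L x‖ ≤ ‖x‖ := by
  have h1 := hL.norm_sq_le x
  have h2 := real_inner_le_norm (L x) x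
  by_contra! h
  nlinarith [norm_nonneg x, norm_nonneg (L x)]

lemma inner_le (hL : FirmlyNonexpansive L) (x : E) : inner ℝ (L x) x ≤ ‖x‖ ^ 2 := by
  have h1 := hL.norm_le x
  have h2 := real_inner_le_norm (L x) x
  nlinarith [norm_nonneg x]

lemma inner_add_smul_symm (hL : FirmlyNonexpansive L) (lam : ℝ) (x y : E) :
    inner ℝ (L x + lam • x) y = inner ℝ x (L y + lam • y) := by
  rw [inner_add_left, inner_add_right, hL.inner_symm, real_inner_smul_left, real_inner_smul_right]

lemma norm_add_smul_sq (L : E →L[ℝ] E) (lam : ℝ) (x : E) :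
    ‖L x + lam • x‖ ^ 2 = ‖L x‖ ^ 2 + 2 * lam * inner ℝ (L x) x + lam ^ 2 * ‖x‖ ^ 2 := by
  rw [norm_add_sq_real, real_inner_smul_right, norm_smul, mul_pow, Real.norm_eq_abs, sq_abs]
  ring

lemma le_norm_add_smul_sq (hL : FirmlyNonexpansive L) (hlam : 0 < lam) (x : E) :
    lam ^ 2 * ‖x‖ ^ 2 ≤ ‖L x + lam • x‖ ^ 2 := by
  rw [norm_add_smul_sq]
  have := mul_nonneg hlam.le (hL.inner_nonneg x)
  nlinarith [sq_nonneg ‖L x‖]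

lemma norm_add_smul_sq_le (hL : FirmlyNonexpansive L) (hlam : 0 < lam) (x : E) :
    ‖L x + lam • x‖ ^ 2 ≤ (lam + 1) ^ 2 * ‖x‖ ^ 2 := by
  rw [norm_add_smul_sq]
  have h1 := mul_le_mul_of_nonneg_left (hL.inner_le x) hlam.le
  linarith [hL.norm_sq_le x, hL.inner_le x]

lemma add_smul_injective (hL : FirmlyNonexpansive L) (hlam : 0 < lam) {x y : E}
    (h : L x + lam • x = L y + lam • y) : x = y := by
  have h1 := hL.le_norm_add_smul_sq hlam (x - y)
  have h2 : L (x - y) + lam • (x - y) = 0 := by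
    rw [map_sub, smul_sub, sub_add_sub_comm, h, sub_self]
  rw [h2, norm_zero] at h1
  have h3 : ‖x - y‖ ^ 2 ≤ 0 := by
    by_contra! hc
    nlinarith [mul_pos (pow_pos hlam 2) hc]
  exact sub_eq_zero.mp (norm_eq_zero.mp (pow_eq_zero_iff two_ne_zero |>.mp
    (le_antisymm h3 (sq_nonneg _))))

lemma add_smul_surjective [CompleteSpace E] (hL : FirmlyNonexpansive L) (hlam : 0 < lam) (y : E) :
    ∃ x, L x + lam • x = y := by
  let B : E →L[ℝ] E →L[ℝ] ℝ := (innerSL ℝ) ∘L (L + lam • ContinuousLinearMap.id ℝ E)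
  have hB : ∀ u v, B u v = inner ℝ (L u + lam • u) v := fun _ _ => rfl
  have hco : IsCoercive B := by
    refine ⟨lam, hlam, fun u => ?_⟩
    rw [hB, inner_add_left, real_inner_smul_left, real_inner_self_eq_norm_sq]
    nlinarith [hL.inner_nonneg u]
  obtain ⟨x, hx⟩ := hco.continuousLinearEquivOfBilin.surjective y
  refine ⟨x, ext_inner_right ℝ fun v => ?_⟩
  rw [← hB, ← hco.continuousLinearEquivOfBilin_apply, hx]

/-- Compressing a firmly nonexpansive operator by an orthogonal projection keeps it so. -/
lemma compression (hL : FirmlyNonexpansive L)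
    (hP : ∀ x y, inner ℝ (P x) y = inner ℝ x (P y)) (hPP : ∀ x, P (P x) = P x) :
    FirmlyNonexpansive (P ∘L L ∘L P) where
  inner_symm x y := by simp [hP, hL.inner_symm]
  norm_sq_le x := by
    have h1 : ‖P (L (P x))‖ ^ 2 ≤ ‖L (P x)‖ ^ 2 := by
      have h2 := real_inner_le_norm (L (P x)) (P (L (P x)))
      rw [← hPP (L (P x)), ← hP, hPP, real_inner_self_eq_norm_sq] at h2
      by_contra! h
      have h3 := lt_of_pow_lt_pow_left₀ 2 (norm_nonneg _) h
      nlinarith [norm_nonneg (L (P x))]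
    calc ‖P (L (P x))‖ ^ 2 ≤ ‖L (P x)‖ ^ 2 := h1
      _ ≤ inner ℝ (L (P x)) (P x) := hL.norm_sq_le _
      _ = inner ℝ (P (L (P x))) x := (hP _ _).symm

/-- The **Kantorovich inequality** for `A = L + lam`, whose spectrum lies in `[lam, lam + 1]`. -/
lemma kantorovich (hL : FirmlyNonexpansive L) (hlam : 0 < lam) (x : E) :
    4 * lam * (lam + 1) * (‖L x + lam • x‖ ^ 2 * ‖x‖ ^ 2)
      ≤ (2 * lam + 1) ^ 2 * (inner ℝ (L x + lam • x) x) ^ 2 := by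
  rw [norm_add_smul_sq, inner_add_left, real_inner_smul_left, real_inner_self_eq_norm_sq]
  have h := hL.norm_sq_le x
  set e := inner ℝ (L x) x
  have h1 : 0 ≤ 4 * lam * (lam + 1) * ‖x‖ ^ 2 := by positivity
  have h2 := mul_le_mul_of_nonneg_left h h1
  nlinarith [sq_nonneg ((2 * lam + 1) * (e + lam * ‖x‖ ^ 2) - 2 * lam * (lam + 1) * ‖x‖ ^ 2)]

/-- The solution `s` of the compressed equation is bounded by the solution `u` of the full
equation. By duality this says that `‖A w‖² ≤ C ‖P A w‖²` for `A = L + lam` and `w` in the range of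
`P`, which is the Kantorovich inequality. -/
lemma compressed_norm_sq_le [CompleteSpace E] (hL : FirmlyNonexpansive L)
    (hP : ∀ x y, inner ℝ (P x) y = inner ℝ x (P y)) (hPP : ∀ x, P (P x) = P x) (hlam : 0 < lam)
    {u s : E} (hs : P s = s) (h : P (L s) + lam • s = L u + lam • u) :
    ‖s‖ ^ 2 ≤ (1 + 1 / (4 * lam ^ 2 + 4 * lam)) * ‖u‖ ^ 2 := by
  obtain ⟨w, hw⟩ := (hL.compression hP hPP).add_smul_surjective hlam s
  simp only [ContinuousLinearMap.comp_apply] at hw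
  have hPw : P w = w := by
    have h1 := congrArg P hw
    rw [map_add, hPP, map_smul, hs, ← hw] at h1
    exact smul_right_injective E hlam.ne' (add_left_cancel h1)
  rw [hPw] at hw
  have e1 : ‖s‖ ^ 2 = inner ℝ u (L w + lam • w) := by
    rw [← hL.inner_add_smul_symm, ← h, inner_add_left, hP, hPw, ← inner_add_left,
      hL.inner_add_smul_symm, ← real_inner_self_eq_norm_sq]
    nth_rewrite 2 [← hw]
    rw [inner_add_right, inner_add_right, ← hP, hs]
  have e2 : inner ℝ (L w + lam • w) w = inner ℝ s w := by
    rw [← hw, inner_add_left, inner_add_left, hP, hPw]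
  have k := hL.kantorovich hlam w
  rw [e2] at k
  have cs := abs_real_inner_le_norm s w
  have cs' := real_inner_le_norm u (L w + lam • w)
  rw [← e1] at cs'
  set a := ‖L w + lam • w‖
  have hc : 1 + 1 / (4 * lam ^ 2 + 4 * lam) = (2 * lam + 1) ^ 2 / (4 * lam * (lam + 1)) := by
    field_simp
    ring
  have hpos : 0 < 4 * lam * (lam + 1) := by positivity
  have ha : 4 * lam * (lam + 1) * a ^ 2 ≤ (2 * lam + 1) ^ 2 * ‖s‖ ^ 2 := by
    rcases eq_or_ne w 0 with rfl | hw0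
    · simp only [a, map_zero, smul_zero, add_zero, norm_zero]
      nlinarith [mul_nonneg (sq_nonneg (2 * lam + 1)) (sq_nonneg ‖s‖)]
    · have hn : 0 < ‖w‖ ^ 2 := by positivity
      have h2 : (inner ℝ s w) ^ 2 ≤ ‖s‖ ^ 2 * ‖w‖ ^ 2 := by
        rw [← mul_pow, ← sq_abs]
        exact pow_le_pow_left₀ (abs_nonneg _) cs 2
      have h3 := mul_le_mul_of_nonneg_left h2 (sq_nonneg (2 * lam + 1))
      refine le_of_mul_le_mul_right ?_ hn
      linarith
  rw [hc, div_mul_eq_mul_div, le_div_iff₀ hpos]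
  rcases (norm_nonneg s).eq_or_lt with h0 | h0
  · rw [← h0]
    have := mul_nonneg (sq_nonneg (2 * lam + 1)) (sq_nonneg ‖u‖)
    simpa using this
  · have h4 : ‖s‖ ^ 2 * ‖s‖ ^ 2 ≤ ‖u‖ ^ 2 * a ^ 2 := by
      rw [← mul_pow ‖u‖, ← sq]
      exact pow_le_pow_left₀ (sq_nonneg _) cs' 2
    have h5 : 0 < ‖s‖ ^ 2 := by positivity
    refine le_of_mul_le_mul_right ?_ h5
    nlinarith [mul_le_mul_of_nonneg_left ha (sq_nonneg ‖u‖),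
      mul_le_mul_of_nonneg_left h4 hpos.le]

/-- A **Wielandt inequality**: if the images of `u` and `v` under `A = L + lam` are orthogonal, then
`u` and `v` make an angle bounded away from `π`, so `u` is controlled by `u + v`. -/
lemma wielandt (hL : FirmlyNonexpansive L) (hlam : 0 < lam) {u v : E}
    (h : inner ℝ (L u + lam • u) (L v + lam • v) = 0) :
    (1 - (lam ^ 2 - (lam + 1) ^ 2) ^ 2 / (lam ^ 2 + (lam + 1) ^ 2) ^ 2) * ‖u‖ ^ 2
      ≤ ‖u + v‖ ^ 2 := by
  -- `k` bounds the cosine of the angle between `u` and `v`.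
  set k : ℝ := (2 * lam + 1) / (lam ^ 2 + (lam + 1) ^ 2) with hk
  have hd : 0 < lam ^ 2 + (lam + 1) ^ 2 := by positivity
  have hk2 : (lam ^ 2 - (lam + 1) ^ 2) ^ 2 / (lam ^ 2 + (lam + 1) ^ 2) ^ 2 = k ^ 2 := by
    rw [hk, div_pow]
    congr 1
    ring
  rw [hk2]
  -- Orthogonality gives `‖A (k u - v)‖ = ‖A (k u + v)‖`; the weight `k` makes the resulting bound
  -- on `⟨u, v⟩` cancel `‖v‖²` exactly.
  have e : ∀ t : ℝ, ‖L (k • u + t • v) + lam • (k • u + t • v)‖ ^ 2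
      = k ^ 2 * ‖L u + lam • u‖ ^ 2 + t ^ 2 * ‖L v + lam • v‖ ^ 2 := by
    intro t
    have : L (k • u + t • v) + lam • (k • u + t • v)
        = k • (L u + lam • u) + t • (L v + lam • v) := by
      simp only [map_add, map_smul]
      module
    rw [this, norm_add_sq_real, real_inner_smul_left, real_inner_smul_right, h, norm_smul,
      norm_smul, mul_pow, mul_pow, Real.norm_eq_abs, Real.norm_eq_abs, sq_abs, sq_abs]
    ring
  have n : ∀ t : ℝ, ‖k • u + t • v‖ ^ 2
      = k ^ 2 * ‖u‖ ^ 2 + 2 * k * t * inner ℝ u v + t ^ 2 * ‖v‖ ^ 2 := by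
    intro t
    rw [norm_add_sq_real, real_inner_smul_left, real_inner_smul_right, norm_smul,
      norm_smul, mul_pow, mul_pow, Real.norm_eq_abs, Real.norm_eq_abs, sq_abs, sq_abs]
    ring
  have h1 := hL.le_norm_add_smul_sq hlam (k • u + (-1 : ℝ) • v)
  have h2 := hL.norm_add_smul_sq_le hlam (k • u + (1 : ℝ) • v)
  rw [e, n] at h1 h2
  have hkd : k * (lam ^ 2 + (lam + 1) ^ 2) = 2 * lam + 1 := by
    rw [hk]
    field_simp
  have h3 : 0 ≤ (2 * lam + 1) * (k ^ 2 * ‖u‖ ^ 2 + 2 * inner ℝ u v + ‖v‖ ^ 2) := by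
    linear_combination h1 + h2 + 2 * inner ℝ u v * hkd
  have h4 := nonneg_of_mul_nonneg_right h3 (by positivity)
  rw [norm_add_sq_real]
  linarith

/-- The solution `u` of the full equation is bounded by the solution `s` of the compressed equation:
`A u = P A s` and `A (s - u) = A s - P A s` are orthogonal. -/
lemma le_compressed_norm_sq (hL : FirmlyNonexpansive L)
    (hP : ∀ x y, inner ℝ (P x) y = inner ℝ x (P y)) (hPP : ∀ x, P (P x) = P x) (hlam : 0 < lam)
    {u s : E} (hs : P s = s) (h : P (L s) + lam • s = L u + lam • u) :
    (1 - (lam ^ 2 - (lam + 1) ^ 2) ^ 2 / (lam ^ 2 + (lam + 1) ^ 2) ^ 2) * ‖u‖ ^ 2 ≤ ‖s‖ ^ 2 := by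
  have e : L (s - u) + lam • (s - u) = L s - P (L s) := by
    rw [map_sub, smul_sub, sub_add_sub_comm, ← h, add_sub_add_right_eq_sub]
  have := hL.wielandt hlam (u := u) (v := s - u) (by
    have hP' : P (P (L s) + lam • s) = P (L s) + lam • s := by rw [map_add, hPP, map_smul, hs]
    rw [e, ← h, ← hP', hP, map_sub, hPP, sub_self, inner_zero_right])
  rwa [add_sub_cancel] at this

end FirmlyNonexpansive

/-- The normal equation of Tikhonov regularization, written for the residual `f - J h`. -/
lemma residual_of_isMinimizer {F : Type*} [NormedAddCommGroup F] [InnerProductSpace ℝ F]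
    [CompleteSpace F] [CompleteSpace E] (J : F →L[ℝ] E) (f : E) {h : F}
    (hh : ∀ g, ‖f - J h‖ ^ 2 + lam * ‖h‖ ^ 2 ≤ ‖f - J g‖ ^ 2 + lam * ‖g‖ ^ 2) :
    J (J.adjoint (f - J h)) + lam • (f - J h) = lam • f := by
  -- `-d` is half the gradient of the objective at `h`.
  set d := J.adjoint (f - J h) - lam • h with hd
  have key : ∀ t : ℝ, 0 ≤ (‖J d‖ ^ 2 + lam * ‖d‖ ^ 2) * (t * t) + (-(2 * ‖d‖ ^ 2)) * t + 0 := by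
    intro t
    have h1 := hh (h + t • d)
    have e : f - J (h + t • d) = (f - J h) - t • J d := by
      rw [map_add, map_smul, sub_sub]
    have e2 : inner ℝ (f - J h) (J d) - lam * inner ℝ h d = ‖d‖ ^ 2 := by
      rw [← ContinuousLinearMap.adjoint_inner_left, ← real_inner_smul_left, ← inner_sub_left,
        ← hd, real_inner_self_eq_norm_sq]
    rw [e, norm_sub_sq_real (f - J h), norm_add_sq_real, real_inner_smul_right,
      real_inner_smul_right,
      norm_smul, norm_smul, mul_pow, mul_pow, Real.norm_eq_abs, sq_abs] at h1
    linear_combination h1 - 2 * t * e2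
  have h0 := discrim_le_zero key
  have hd0 : d = 0 := by
    rw [discrim] at h0
    have h1 : ‖d‖ ^ 2 = 0 := by nlinarith [sq_nonneg (‖d‖ ^ 2)]
    simpa using h1
  have h2 : J.adjoint (f - J h) = lam • h := sub_eq_zero.mp hd0
  rw [h2, map_smul, ← smul_add, add_sub_cancel]

lemma firmlyNonexpansive_comp_adjoint {F : Type*} [NormedAddCommGroup F] [InnerProductSpace ℝ F]
    [CompleteSpace F] [CompleteSpace E] (J : F →L[ℝ] E) (hJ : ∀ x, ‖J x‖ ≤ ‖x‖) :
    FirmlyNonexpansive (J ∘L J.adjoint) where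
  inner_symm x y := by
    simp only [ContinuousLinearMap.comp_apply]
    rw [← ContinuousLinearMap.adjoint_inner_right, ContinuousLinearMap.adjoint_inner_left]
  norm_sq_le x := by
    simp only [ContinuousLinearMap.comp_apply]
    rw [← ContinuousLinearMap.adjoint_inner_right, real_inner_self_eq_norm_sq]
    exact pow_le_pow_left₀ (norm_nonneg _) (hJ _) 2

end Hilbert

/-! ### The integral operator of a kernel -/

namespace ContKernel

section IntegralOperator

variable {X : Type u} [TopologicalSpace X] (K : ContKernel X)

lemma apply_self_nonneg (x : X) : 0 ≤ K x x := by
  obtain ⟨F, _, _, _, Φ, hΦ⟩ := K.exists_featureMap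
  rw [hΦ]
  exact real_inner_self_nonneg

lemma norm_apply_le_of_sqrt_le {C : ℝ} (hC : ∀ x, √(K x x) ≤ C) (h : K.Rkhs) (x : X) :
    ‖h x‖ ≤ ‖h‖ * C := by
  refine (RKHS.norm_apply_le h x).trans (mul_le_mul_of_nonneg_left ?_ (norm_nonneg _))
  have h1 : ‖RKHS.kernel K.Rkhs x x‖ ≤ K x x := by
    rw [RKHS.OfKernel.kernel_ofKernel]
    simp [toMatrix, norm_smul, abs_of_nonneg (K.apply_self_nonneg x)]
  exact (Real.sqrt_le_sqrt h1).trans (hC x)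

lemma kerFun_one_apply (x y : X) : RKHS.kerFun K.Rkhs x (1 : ℝ) y = K x y := by
  rw [RKHS.kerFun_apply, RKHS.OfKernel.kernel_ofKernel, toMatrix_apply, mul_one, K.symm_apply]

variable [MeasurableSpace X] [CompactSpace X] [OpensMeasurableSpace X] (μ : Measure X)
  [IsFiniteMeasure μ]

/-- The inclusion of the reproducing kernel Hilbert space into `L²(μ)`, as a linear map. -/
noncomputable def inclusionLinearMap : K.Rkhs →ₗ[ℝ] Lp ℝ 2 μ where
  toFun h := (K.memLp_coe μ h).toLp (h : X → ℝ)
  map_add' g h := by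
    rw [← MemLp.toLp_add]
    exact MemLp.toLp_congr _ _ (by rw [RKHS.coe_add])
  map_smul' c h := by
    rw [RingHom.id_apply, ← MemLp.toLp_const_smul]
    exact MemLp.toLp_congr _ _ (by rw [RKHS.coe_smul])

lemma norm_inclusionLinearMap_le {C : ℝ} (hC0 : 0 ≤ C) (hC : ∀ x, √(K x x) ≤ C) (h : K.Rkhs) :
    ‖K.inclusionLinearMap μ h‖ ≤ (measureUnivNNReal μ : ℝ) ^ (ENNReal.toReal 2)⁻¹ * (‖h‖ * C) := by
  refine Lp.norm_le_of_ae_bound (by positivity) ?_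
  filter_upwards [(K.memLp_coe μ h).coeFn_toLp] with x hx
  change ‖((K.memLp_coe μ h).toLp (h : X → ℝ) : X → ℝ) x‖ ≤ _
  rw [hx]
  exact K.norm_apply_le_of_sqrt_le hC h x

/-- The inclusion of the reproducing kernel Hilbert space into `L²(μ)`. -/
noncomputable def inclusion : K.Rkhs →L[ℝ] Lp ℝ 2 μ :=
  (K.inclusionLinearMap μ).mkContinuousOfExistsBound <| by
    have hdiag : Continuous fun x => √(K x x) :=
      (K.continuous_toFun.comp (continuous_id.prodMk continuous_id)).sqrt
    obtain ⟨C, hC⟩ := (isCompact_range hdiag).isBounded.exists_norm_le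
    refine ⟨(measureUnivNNReal μ : ℝ) ^ (ENNReal.toReal 2)⁻¹ * |C|, fun h => ?_⟩
    have := K.norm_inclusionLinearMap_le μ (abs_nonneg C)
      (fun x => (le_abs_self _).trans ((hC _ (Set.mem_range_self x)).trans (le_abs_self C))) h
    linarith

lemma coeFn_inclusion (h : K.Rkhs) : K.inclusion μ h =ᵐ[μ] h :=
  (K.memLp_coe μ h).coeFn_toLp

lemma norm_inclusion_le {μ : Measure X} [IsProbabilityMeasure μ] (hK : ∀ x, K x x ≤ 1)
    (h : K.Rkhs) : ‖K.inclusion μ h‖ ≤ ‖h‖ := by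
  have : ‖K.inclusion μ h‖ ≤ _ := K.norm_inclusionLinearMap_le μ zero_le_one
    (fun x => (Real.sqrt_le_sqrt (hK x)).trans_eq Real.sqrt_one) h
  simpa [measureUnivNNReal] using this

/-- The integral operator `r ↦ ∫ K(·, y) r(y) dμ(y)` on `L²(μ)`, factored through the reproducing
kernel Hilbert space. -/
noncomputable def integralOperator : Lp ℝ 2 μ →L[ℝ] Lp ℝ 2 μ :=
  K.inclusion μ ∘L (K.inclusion μ).adjoint

lemma coeFn_integralOperator (r : Lp ℝ 2 μ) :
    K.integralOperator μ r =ᵐ[μ] fun x => ∫ y, K x y * r y ∂μ := by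
  refine (K.coeFn_inclusion μ _).trans (Filter.Eventually.of_forall fun x => ?_)
  have h1 : (K.inclusion μ).adjoint r x
      = inner ℝ ((K.inclusion μ).adjoint r) (RKHS.kerFun K.Rkhs x (1 : ℝ)) := by
    rw [RKHS.inner_kerFun]
    simp
  change (K.inclusion μ).adjoint r x = _
  rw [h1, ContinuousLinearMap.adjoint_inner_left, L2.inner_def]
  refine integral_congr_ae ?_
  filter_upwards [K.coeFn_inclusion μ (RKHS.kerFun K.Rkhs x (1 : ℝ))] with y hy
  rw [hy, kerFun_one_apply]
  simp

lemma firmlyNonexpansive_integralOperator {μ : Measure X} [IsProbabilityMeasure μ]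
    (hK : ∀ x, K x x ≤ 1) : FirmlyNonexpansive (K.integralOperator μ) :=
  firmlyNonexpansive_comp_adjoint _ (K.norm_inclusion_le hK)

lemma integrable_mul (x : X) (r : Lp ℝ 2 μ) : Integrable (fun y => K x y * r y) μ := by
  have hc : Continuous fun y => K x y :=
    K.continuous_toFun.comp (continuous_const.prodMk continuous_id)
  obtain ⟨C, hC⟩ := (isCompact_range hc).isBounded.exists_norm_le
  exact ((Lp.memLp r).integrable one_le_two).bdd_mul hc.aestronglyMeasurable
    (Filter.Eventually.of_forall fun y => hC _ (Set.mem_range_self y))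

lemma norm_toLp_sub_inclusion_sq {μ : Measure X} [IsFiniteMeasure μ] {f : X → ℝ}
    (hf : MemLp f 2 μ) (h : K.Rkhs) :
    ‖hf.toLp f - K.inclusion μ h‖ ^ 2 = ∫ x, (f x - h x) ^ 2 ∂μ := by
  rw [← real_inner_self_eq_norm_sq, L2.inner_def]
  refine integral_congr_ae ?_
  filter_upwards [Lp.coeFn_sub (hf.toLp f) (K.inclusion μ h), hf.coeFn_toLp,
    K.coeFn_inclusion μ h] with x h1 h2 h3
  rw [h1, Pi.sub_apply, h2, h3]
  simp [sq]

/-- The bias caused by regularization is the squared norm of `lam (L + lam)⁻¹ f`, where `L` is the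
integral operator of the kernel. -/
lemma exists_residual {μ : Measure X} [IsFiniteMeasure μ] {f : X → ℝ} (hf : MemLp f 2 μ)
    {lam : ℝ} (hlam : 0 < lam) :
    ∃ r : Lp ℝ 2 μ, K.integralOperator μ r + lam • r = lam • hf.toLp f ∧
      K.regularizationBias μ f lam = ‖r‖ ^ 2 := by
  have hmin : ∀ g, K.regularizedRisk μ f lam (K.regularizedMinimizer μ f lam)
      ≤ K.regularizedRisk μ f lam g :=
    Classical.epsilon_spec (K.existsUnique_minimizer μ hf hlam).exists
  refine ⟨hf.toLp f - K.inclusion μ (K.regularizedMinimizer μ f lam), ?_,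
    (K.norm_toLp_sub_inclusion_sq hf _).symm⟩
  refine residual_of_isMinimizer (K.inclusion μ) _ fun g => ?_
  rw [norm_toLp_sub_inclusion_sq, norm_toLp_sub_inclusion_sq]
  exact hmin g

end IntegralOperator

/-! ### The swap on square integrable functions -/

section Swap

variable {D : Type u} [MeasurableSpace D] {μ : Measure (D × D)}

/-- Composition with the swap, as an operator on `L²(μ)`. -/
noncomputable def swapOperator (hs : MeasurePreserving Prod.swap μ μ) :
    Lp ℝ 2 μ →L[ℝ] Lp ℝ 2 μ :=
  (Lp.compMeasurePreservingₗᵢ ℝ Prod.swap hs).toContinuousLinearMap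

lemma coeFn_swapOperator (hs : MeasurePreserving Prod.swap μ μ) (r : Lp ℝ 2 μ) :
    swapOperator hs r =ᵐ[μ] fun x => r x.swap :=
  Lp.coeFn_compMeasurePreserving r hs

lemma swapOperator_swapOperator (hs : MeasurePreserving Prod.swap μ μ) (r : Lp ℝ 2 μ) :
    swapOperator hs (swapOperator hs r) = r := by
  refine Lp.ext ?_
  filter_upwards [coeFn_swapOperator hs (swapOperator hs r),
    hs.quasiMeasurePreserving.ae (coeFn_swapOperator hs r)] with x h1 h2
  rw [h1, h2, Prod.swap_swap]

lemma inner_swapOperator_left (hs : MeasurePreserving Prod.swap μ μ) (r s : Lp ℝ 2 μ) :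
    inner ℝ (swapOperator hs r) s = inner ℝ r (swapOperator hs s) := by
  nth_rewrite 1 [← swapOperator_swapOperator hs s]
  let V : Lp ℝ 2 μ →ₗᵢ[ℝ] Lp ℝ 2 μ := Lp.compMeasurePreservingₗᵢ ℝ Prod.swap hs
  exact V.inner_map_map _ _

lemma integral_mul_swapOperator (hs : MeasurePreserving Prod.swap μ μ) (g : D × D → ℝ)
    (r : Lp ℝ 2 μ) :
    ∫ y, g y * swapOperator hs r y ∂μ = ∫ y : D × D, g y.swap * r y ∂μ := by
  rw [← hs.integral_comp MeasurableEquiv.prodComm.measurableEmbedding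
    (fun y => g y * swapOperator hs r y)]
  refine integral_congr_ae ?_
  filter_upwards [hs.quasiMeasurePreserving.ae (coeFn_swapOperator hs r)] with y hy
  rw [hy, Prod.swap_swap]

/-- For `σ = 1` or `σ = -1` the orthogonal projection `(1 + σ U) / 2` onto the functions `r` with
`U r = σ r`, where `U` is the swap. -/
noncomputable def swapProjection (hs : MeasurePreserving Prod.swap μ μ) (σ : ℝ) :
    Lp ℝ 2 μ →L[ℝ] Lp ℝ 2 μ :=
  (1 / 2 : ℝ) • (ContinuousLinearMap.id ℝ _ + σ • swapOperator hs)

variable {hs : MeasurePreserving Prod.swap μ μ} {σ : ℝ}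

lemma swapProjection_apply (r : Lp ℝ 2 μ) :
    swapProjection hs σ r = (1 / 2 : ℝ) • (r + σ • swapOperator hs r) := rfl

lemma inner_swapProjection_left (r s : Lp ℝ 2 μ) :
    inner ℝ (swapProjection hs σ r) s = inner ℝ r (swapProjection hs σ s) := by
  simp only [swapProjection_apply, real_inner_smul_left, real_inner_smul_right, inner_add_left,
    inner_add_right, inner_swapOperator_left]

lemma swapProjection_swapProjection (hσ : σ * σ = 1) (r : Lp ℝ 2 μ) :
    swapProjection hs σ (swapProjection hs σ r) = swapProjection hs σ r := by
  simp only [swapProjection_apply, map_smul, map_add, swapOperator_swapOperator]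
  rcases mul_self_eq_one_iff.mp hσ with rfl | rfl <;> module

lemma swapProjection_eq_self (hσ : σ * σ = 1) {r : Lp ℝ 2 μ} (hr : swapOperator hs r = σ • r) :
    swapProjection hs σ r = r := by
  rw [swapProjection_apply, hr, smul_smul, hσ]
  module

end Swap

/-! ### Integral operators of pairwise kernels -/

section Pairwise

lemma permInv_apply_self_le {D : Type u} [TopologicalSpace D] {K : ContKernel (D × D)}
    (hK : ∀ x, K x x ≤ 1) (x : D × D) : K.permInv x x ≤ 1 := by
  simp only [permInv]
  linarith [hK x, hK x.swap]

variable {D : Type u} [TopologicalSpace D] [CompactSpace D] [MeasurableSpace D]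
  [OpensMeasurableSpace (D × D)] {μ : Measure (D × D)} [IsFiniteMeasure μ]
  (K : ContKernel (D × D)) (hs : MeasurePreserving Prod.swap μ μ)

lemma integrable_mul_swap (x : D × D) (r : Lp ℝ 2 μ) :
    Integrable (fun y : D × D => K x y.swap * r y) μ := by
  have hc : Continuous fun y : D × D => K x y.swap :=
    K.continuous_toFun.comp (continuous_const.prodMk continuous_swap)
  obtain ⟨C, hC⟩ := (isCompact_range hc).isBounded.exists_norm_le
  exact ((Lp.memLp r).integrable one_le_two).bdd_mul hc.aestronglyMeasurable
    (Filter.Eventually.of_forall fun y => hC _ (Set.mem_range_self y))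

lemma coeFn_swap_integralOperator (r : Lp ℝ 2 μ) :
    swapOperator hs (K.integralOperator μ r) =ᵐ[μ] fun x => ∫ y, K x.swap y * r y ∂μ := by
  filter_upwards [coeFn_swapOperator hs (K.integralOperator μ r),
    hs.quasiMeasurePreserving.ae (K.coeFn_integralOperator μ r)] with x h1 h2
  rw [h1, h2]

lemma coeFn_integralOperator_swap (r : Lp ℝ 2 μ) :
    K.integralOperator μ (swapOperator hs r) =ᵐ[μ]
      fun x => ∫ y : D × D, K x y.swap * r y ∂μ := by
  filter_upwards [K.coeFn_integralOperator μ (swapOperator hs r)] with x hx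
  rw [hx, integral_mul_swapOperator]

lemma coeFn_swap_integralOperator_swap (r : Lp ℝ 2 μ) :
    swapOperator hs (K.integralOperator μ (swapOperator hs r)) =ᵐ[μ]
      fun x => ∫ y : D × D, K x.swap y.swap * r y ∂μ := by
  filter_upwards [K.coeFn_swap_integralOperator hs (swapOperator hs r)] with x hx
  rw [hx, integral_mul_swapOperator]

lemma integralOperator_permInv (r : Lp ℝ 2 μ) :
    K.permInv.integralOperator μ r = (1 / 2 : ℝ) • (K.integralOperator μ r
      + swapOperator hs (K.integralOperator μ (swapOperator hs r))) := by
  refine Lp.ext ?_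
  filter_upwards [K.permInv.coeFn_integralOperator μ r, K.coeFn_integralOperator μ r,
    K.coeFn_swap_integralOperator_swap hs r,
    Lp.coeFn_smul (1 / 2 : ℝ) (K.integralOperator μ r
      + swapOperator hs (K.integralOperator μ (swapOperator hs r))),
    Lp.coeFn_add (K.integralOperator μ r)
      (swapOperator hs (K.integralOperator μ (swapOperator hs r)))] with x h1 h2 h3 h4 h5
  rw [h1, h4, Pi.smul_apply, h5, Pi.add_apply, h2, h3,
    ← integral_add (K.integrable_mul μ x r) (K.integrable_mul_swap x.swap r), smul_eq_mul,
    ← integral_const_mul]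
  refine integral_congr_ae (Filter.Eventually.of_forall fun y => ?_)
  simp only [permInv]
  ring

/-- The kernel that is symmetrized (`σ = 1`) or anti-symmetrized (`σ = -1`) in both arguments has as
integral operator the compression of the one of `K` to the functions `r` with `U r = σ r`. -/
lemma integralOperator_eq_compression {σ : ℝ} (hσ : σ * σ = 1) (T : ContKernel (D × D))
    (hT : ∀ x y, T x y
      = 1 / 4 * (K x y + σ * K x.swap y + σ * K x y.swap + K x.swap y.swap)) :
    T.integralOperator μ
      = swapProjection hs σ ∘L K.integralOperator μ ∘L swapProjection hs σ := by
  ext1 r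
  have e : (swapProjection hs σ ∘L K.integralOperator μ ∘L swapProjection hs σ) r
      = (1 / 4 : ℝ) • (K.integralOperator μ r + σ • swapOperator hs (K.integralOperator μ r)
        + σ • K.integralOperator μ (swapOperator hs r)
        + swapOperator hs (K.integralOperator μ (swapOperator hs r))) := by
    simp only [ContinuousLinearMap.comp_apply, swapProjection_apply, map_smul, map_add]
    rcases mul_self_eq_one_iff.mp hσ with rfl | rfl <;> module
  rw [e]
  set a := K.integralOperator μ r with ha
  set b := swapOperator hs a with hb
  set c := K.integralOperator μ (swapOperator hs r) with hc
  set d := swapOperator hs c with hd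
  refine Lp.ext ?_
  filter_upwards [T.coeFn_integralOperator μ r, K.coeFn_integralOperator μ r,
    K.coeFn_swap_integralOperator hs r, K.coeFn_integralOperator_swap hs r,
    K.coeFn_swap_integralOperator_swap hs r,
    Lp.coeFn_smul (1 / 4 : ℝ) (a + σ • b + σ • c + d), Lp.coeFn_add (a + σ • b + σ • c) d,
    Lp.coeFn_add (a + σ • b) (σ • c), Lp.coeFn_add a (σ • b), Lp.coeFn_smul σ b,
    Lp.coeFn_smul σ c] with x h0 h1 h2 h3 h4 h5 h6 h7 h8 h9 h10
  have i1 := K.integrable_mul μ x r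
  have i2 := (K.integrable_mul μ x.swap r).const_mul σ
  have i3 := (K.integrable_mul_swap x r).const_mul σ
  have i4 := K.integrable_mul_swap x.swap r
  have i12 : Integrable (fun y => K x y * r y + σ * (K x.swap y * r y)) μ := i1.add i2
  have i123 : Integrable (fun y => K x y * r y + σ * (K x.swap y * r y)
      + σ * (K x y.swap * r y)) μ := i12.add i3
  rw [h0, h5, Pi.smul_apply, h6, Pi.add_apply, h7, Pi.add_apply, h8, Pi.add_apply, h9, h10,
    Pi.smul_apply, Pi.smul_apply, h1, h2, h3, h4, smul_eq_mul, smul_eq_mul, smul_eq_mul,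
    ← integral_const_mul σ, ← integral_const_mul σ, ← integral_add i1 i2,
    ← integral_add i12 i3, ← integral_add i123 i4, ← integral_const_mul]
  refine integral_congr_ae (Filter.Eventually.of_forall fun y => ?_)
  simp only [hT]
  ring

end Pairwise

/-! ### Comparison of the biases -/

section Bias

variable {D : Type u} [TopologicalSpace D] [CompactSpace D] [MeasurableSpace D]
  [OpensMeasurableSpace (D × D)] {μ : Measure (D × D)} [IsProbabilityMeasure μ]
  {K : ContKernel (D × D)} {f : D × D → ℝ} {σ lam : ℝ}

/-- For `f` with `f ∘ swap = σ f` the residual for the permutation invariant form inherits this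
symmetry, hence solves the equation compressed to the functions with this symmetry. -/
lemma exists_compressed_residual (hs : MeasurePreserving Prod.swap μ μ) (hK : ∀ x, K x x ≤ 1)
    (hf : MemLp f 2 μ) (hσ : σ * σ = 1) (hfσ : ∀ᵐ x ∂μ, f x.swap = σ * f x) (hlam : 0 < lam) :
    ∃ s : Lp ℝ 2 μ, swapProjection hs σ s = s ∧
      swapProjection hs σ (K.integralOperator μ s) + lam • s = lam • hf.toLp f ∧
      K.permInv.regularizationBias μ f lam = ‖s‖ ^ 2 := by
  obtain ⟨s, hs1, hs2⟩ := K.permInv.exists_residual hf hlam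
  have hF : swapOperator hs (hf.toLp f) = σ • hf.toLp f := by
    refine Lp.ext ?_
    filter_upwards [coeFn_swapOperator hs (hf.toLp f),
      hs.quasiMeasurePreserving.ae hf.coeFn_toLp, hf.coeFn_toLp,
      Lp.coeFn_smul σ (hf.toLp f), hfσ] with x h1 h2 h3 h4 h5
    rw [h1, h2, h4, Pi.smul_apply, h3, h5, smul_eq_mul]
  have hcomm : K.permInv.integralOperator μ (swapOperator hs s)
      = swapOperator hs (K.permInv.integralOperator μ s) := by
    rw [K.integralOperator_permInv hs, K.integralOperator_permInv hs, map_smul, map_add,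
      swapOperator_swapOperator, swapOperator_swapOperator, add_comm]
  have hU : swapOperator hs s = σ • s := by
    refine (K.permInv.firmlyNonexpansive_integralOperator
      (permInv_apply_self_le hK)).add_smul_injective hlam ?_
    rw [hcomm, ← map_smul, ← map_add, hs1, map_smul, map_smul, smul_comm lam σ s, ← smul_add, hs1,
      hF, smul_comm]
  refine ⟨s, swapProjection_eq_self hσ hU, ?_, hs2⟩
  rw [← hs1, K.integralOperator_permInv hs, hU, map_smul, map_smul, swapProjection_apply]

lemma regularizationBias_permInv_eq (hs : MeasurePreserving Prod.swap μ μ) (hK : ∀ x, K x x ≤ 1)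
    (hf : MemLp f 2 μ) (hσ : σ * σ = 1) (hfσ : ∀ᵐ x ∂μ, f x.swap = σ * f x) (hlam : 0 < lam)
    (T : ContKernel (D × D)) (hT : ∀ x y, T x y
      = 1 / 4 * (K x y + σ * K x.swap y + σ * K x y.swap + K x.swap y.swap)) :
    K.permInv.regularizationBias μ f lam = T.regularizationBias μ f lam := by
  obtain ⟨s, hs1, hs2, hs3⟩ := exists_compressed_residual hs hK hf hσ hfσ hlam
  obtain ⟨r, hr1, hr2⟩ := T.exists_residual hf hlam
  have hL := (K.firmlyNonexpansive_integralOperator (μ := μ) hK).compression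
    (P := swapProjection hs σ) inner_swapProjection_left (swapProjection_swapProjection hσ)
  rw [K.integralOperator_eq_compression hs hσ T hT] at hr1
  rw [hs3, hr2, hL.add_smul_injective hlam (x := s) (y := r)]
  rw [hr1, ← hs2, ContinuousLinearMap.comp_apply, ContinuousLinearMap.comp_apply, hs1]

lemma regularizationBias_permInv_bounds (hs : MeasurePreserving Prod.swap μ μ)
    (hK : ∀ x, K x x ≤ 1) (hf : MemLp f 2 μ) (hσ : σ * σ = 1)
    (hfσ : ∀ᵐ x ∂μ, f x.swap = σ * f x) (hlam : 0 < lam) :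
    (1 - (lam ^ 2 - (lam + 1) ^ 2) ^ 2 / (lam ^ 2 + (lam + 1) ^ 2) ^ 2)
        * K.regularizationBias μ f lam ≤ K.permInv.regularizationBias μ f lam ∧
      K.permInv.regularizationBias μ f lam
        ≤ (1 + 1 / (4 * lam ^ 2 + 4 * lam)) * K.regularizationBias μ f lam := by
  obtain ⟨s, hs1, hs2, hs3⟩ := exists_compressed_residual hs hK hf hσ hfσ hlam
  obtain ⟨u, hu1, hu2⟩ := K.exists_residual hf hlam
  have hL := K.firmlyNonexpansive_integralOperator (μ := μ) hK
  rw [hs3, hu2]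
  exact ⟨hL.le_compressed_norm_sq inner_swapProjection_left (swapProjection_swapProjection hσ)
      hlam hs1 (hs2.trans hu1.symm),
    hL.compressed_norm_sq_le inner_swapProjection_left (swapProjection_swapProjection hσ)
      hlam hs1 (hs2.trans hu1.symm)⟩

end Bias

end ContKernel

theorem mainTheorem3 {D : Type u} [MetricSpace D] [CompactSpace D] [MeasurableSpace D]
    [BorelSpace D] (μ : Measure (D × D)) [IsProbabilityMeasure μ]
    (hμ : μ.map Prod.swap = μ)
    (K : ContKernel (D × D)) (hK : IsGreatest (Set.range fun x => K x x) 1)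
    (f : D × D → ℝ) (hf : MemLp f 2 μ) :
    ((∀ᵐ x ∂μ, f x.swap = f x) → ∀ lam : ℝ, 0 < lam →
      K.permInv.regularizationBias μ f lam = K.symmForm.regularizationBias μ f lam) ∧
    ((∀ᵐ x ∂μ, f x.swap = -f x) → ∀ lam : ℝ, 0 < lam →
      K.permInv.regularizationBias μ f lam = K.antisymmForm.regularizationBias μ f lam) ∧
    (((∀ᵐ x ∂μ, f x.swap = f x) ∨ (∀ᵐ x ∂μ, f x.swap = -f x)) → ∀ lam : ℝ, 0 < lam →
      (1 - (lam ^ 2 - (lam + 1) ^ 2) ^ 2 / (lam ^ 2 + (lam + 1) ^ 2) ^ 2)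
          * K.regularizationBias μ f lam ≤ K.permInv.regularizationBias μ f lam ∧
      K.permInv.regularizationBias μ f lam
        ≤ (1 + 1 / (4 * lam ^ 2 + 4 * lam)) * K.regularizationBias μ f lam) := by
  have hs : MeasurePreserving Prod.swap μ μ := ⟨measurable_swap, hμ⟩
  have hK1 : ∀ x, K x x ≤ 1 := fun x => hK.2 ⟨x, rfl⟩
  have hpos : (∀ᵐ x ∂μ, f x.swap = f x) → ∀ᵐ x ∂μ, f x.swap = 1 * f x := fun h => by
    simpa only [one_mul] using h
  have hneg : (∀ᵐ x ∂μ, f x.swap = -f x) → ∀ᵐ x ∂μ, f x.swap = -1 * f x := fun h => by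
    simpa only [neg_one_mul] using h
  refine ⟨fun h lam hlam => ?_, fun h lam hlam => ?_, ?_⟩
  · refine ContKernel.regularizationBias_permInv_eq hs hK1 hf (one_mul 1) (hpos h) hlam _
      fun x y => ?_
    simp only [ContKernel.symmForm]
    ring
  · refine ContKernel.regularizationBias_permInv_eq hs hK1 hf (σ := -1) (by norm_num) (hneg h) hlam
      _ fun x y => ?_
    simp only [ContKernel.antisymmForm]
    ring
  · rintro (h | h) lam hlam
    · exact ContKernel.regularizationBias_permInv_bounds hs hK1 hf (one_mul 1) (hpos h) hlam
    · exact ContKernel.regularizationBias_permInv_bounds hs hK1 hf (σ := -1) (by norm_num) (hneg h)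
        hlam
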